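/- Let $G$ be a finite nonabelian simple group and let $\gamma : H \to G$ be a finite minimal extension, i.e. $H$ is a finite group, $\gamma$ is a surjective homomorphism, and $\gamma(K) < G$ for every proper subgroup $K < H$. Let $k$ be an algebraically closed field, let $m$ be a natural number, and let $\lambda : H \to \mathrm{PGL}_m(k)$ be a primitive projective representation: writing $V = k^m$ and letting $\widehat{H}$ be the full preimage of $\lambda(H)$ in $\mathrm{GL}(V)$, this means that $\lambda$ is irreducible ($V \neq 0$, and $0$ and $V$ are the only $\widehat{H}$-invariant subspaces of $V$) and that there is no direct sum decomposition $V = V_1 \oplus \cdots \oplus V_t$ with $t > 1$ and all $V_i \neq 0$ such that $\widehat{H}$ permutes the subspaces $V_1, \dots, V_t$ among themselves. Let $n_G$ be the least $n$ for which there is an injective homomorphism $G \to \mathrm{Sp}_{2n}(2)$ such that the resulting action of $G$ on $\mathbb{F}_2^{2n}$ is irreducible over $\mathbb{F}_2$. If $\mathrm{char}\, k \neq 2$, assume that $m < 2^{n_G}$. Then $\ker \gamma \leq \ker \lambda$. -/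

import Mathlib

/-- A minimal extension `γ : H → G`: a surjective homomorphism such that no proper subgroup
of `H` is mapped onto `G`. -/
def IsMinimalExtension {H G : Type*} [Group H] [Group G] (γ : H →* G) : Prop :=
  Function.Surjective γ ∧ ∀ K : Subgroup H, K < ⊤ → K.map γ < ⊤

/-- The linear representation on `𝔽₂^{2n}` afforded by a homomorphism `G → Sp_{2n}(2)`. -/
noncomputable def symplecticRep {G : Type*} [Group G] {n : ℕ}
    (f : G →* Matrix.symplecticGroup (Fin n) (ZMod 2)) :
    Representation (ZMod 2) G (Fin n ⊕ Fin n → ZMod 2) :=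
  (Matrix.toLinAlgEquiv' : Matrix (Fin n ⊕ Fin n) (Fin n ⊕ Fin n) (ZMod 2) ≃ₐ[ZMod 2] _).toMonoidHom.comp
    ((Matrix.symplecticGroup (Fin n) (ZMod 2)).subtype.comp f)

/-- `G` embeds in `Sp_{2n}(2)` as an irreducible subgroup. -/
def EmbedsIrreduciblyInSp (G : Type*) [Group G] (n : ℕ) : Prop :=
  ∃ f : G →* Matrix.symplecticGroup (Fin n) (ZMod 2),
    Function.Injective f ∧ (symplecticRep f).IsIrreducible

/-- The least `n` such that `G` embeds irreducibly in `Sp_{2n}(2)` (and `∞` if there is no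
such `n`, so that the value is a genuine minimum whenever it is finite). -/
noncomputable def symplecticDegree (G : Type*) [Group G] : ℕ∞ :=
  sInf {N : ℕ∞ | ∃ n : ℕ, N = n ∧ EmbedsIrreduciblyInSp G n}

namespace ProjRep

variable {H k : Type*} [Group H] [Field k] {m : ℕ}

/-- The full preimage in `GL_m(k)` of the image of a projective representation
`ρ : H → PGL_m(k)`. -/
def preimage (ρ : H →* Matrix.ProjGenLinGroup (Fin m) k) :
    Subgroup (Matrix.GeneralLinearGroup (Fin m) k) :=
  ρ.range.comap Matrix.ProjGenLinGroup.mk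

/-- The image `A W` of a subspace `W` of `k^m` under `A ∈ GL_m(k)`. -/
noncomputable def translate (A : Matrix.GeneralLinearGroup (Fin m) k)
    (W : Submodule k (Fin m → k)) : Submodule k (Fin m → k) :=
  W.map (Matrix.toLin' (A : Matrix (Fin m) (Fin m) k))

/-- `ρ` is irreducible: `k^m` is nonzero, and the preimage of the image of `ρ` in `GL_m(k)`
leaves no subspace invariant other than `0` and `k^m`. -/
def IsIrreducible (ρ : H →* Matrix.ProjGenLinGroup (Fin m) k) : Prop :=
  0 < m ∧ ∀ W : Submodule k (Fin m → k),
    (∀ A ∈ preimage ρ, translate A W = W) → W = ⊥ ∨ W = ⊤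

/-- `ρ` is imprimitive: the preimage of the image of `ρ` in `GL_m(k)` permutes among themselves
the (nonzero) subspaces of a direct sum decomposition of `k^m` with more than one summand. -/
def IsImprimitive (ρ : H →* Matrix.ProjGenLinGroup (Fin m) k) : Prop :=
  ∃ (t : ℕ) (V : Fin t → Submodule k (Fin m → k)),
    1 < t ∧ (∀ i, V i ≠ ⊥) ∧ DirectSum.IsInternal V ∧
      ∀ A ∈ preimage ρ, ∃ σ : Equiv.Perm (Fin t), ∀ i, translate A (V i) = V (σ i)

/-- `ρ` is primitive: irreducible and not imprimitive. -/
def IsPrimitive (ρ : H →* Matrix.ProjGenLinGroup (Fin m) k) : Prop :=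
  IsIrreducible ρ ∧ ¬ IsImprimitive ρ

end ProjRep

/-! Factoring out `ρ.ker` makes ρ faithful; suppose then that N = ker γ ≠ 1. Minimality puts N in
the Frattini subgroup, so N is nilpotent and Z(N) contains a minimal normal subgroup A of H, of
prime exponent p. Commutators of lifts of A to GL(V) are scalars and define an H-invariant
alternating pairing ω on A. Its radical is normal in H, hence 1 or A. It is not A: the lifts of A
would then form an abelian normal subgroup, scalar by primitivity (`IsPrimitive.scalar_of_commute`).
So ω is nondegenerate.

If p is odd, ω has a square root, and Baer's trick yields a complement of A in H
(`exists_complement_of_odd`), impossible inside the Frattini subgroup. If p = 2, then char k ≠ 2 and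
A is a faithful irreducible symplectic 𝔽₂G-module of some dimension 2n, so n ≥ n_G. Lifts of the
elements of A are linearly independent matrices (`card_le_sq_of_pairing`), so 2^(2n) ≤ m², against m
< 2^(n_G). -/

/-! ### Baer's trick and supplements -/

/-- A central extension `E` of an abelian group by a divisible group `K`, whose commutator pairing
is the square of an alternating bilinear pairing `t`, admits a retraction onto `K` which is
multiplicative up to `t`. -/
theorem exists_twisted_retraction {E K : Type*} [Group E] [CommGroup K]
    [DivisibleBy (Additive K) ℤ] (i : K →* E) (hi : Function.Injective i)
    (hc : ∀ c x, i c * x = x * i c) (t : E →* E →* K)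
    (ht : ∀ x y, x * y = i (t x y ^ 2) * (y * x)) (htt : ∀ x, t x x = 1)
    (hti : ∀ c x, t (i c) x = 1) :
    ∃ r : E → K, (∀ x y, r (x * y) = t x y * (r x * r y)) ∧ ∀ c, r (i c) = c := by
  have hskew : ∀ x y, t x y * t y x = 1 := by
    intro x y
    have := htt (x * y)
    simpa [htt] using this
  have hti' : ∀ c x, t x (i c) = 1 := by
    intro c x
    simpa [hti] using hskew x (i c)
  have htl : ∀ c x y z, t (i c * (x * y)) z = t x z * t y z := by
    intro c x y z
    rw [map_mul, map_mul, MonoidHom.mul_apply, MonoidHom.mul_apply, hti, one_mul]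
  have htr : ∀ c x y z, t x (i c * (y * z)) = t x y * t x z := by
    intro c x y z
    rw [map_mul, map_mul, hti', one_mul]
  -- Baer's trick: `t` is half the commutator, so dividing the product by it gives a commutative
  -- operation, associative because `t` is bimultiplicative.
  let _ : Add E := ⟨fun x y => i (t x y)⁻¹ * (x * y)⟩
  let _ : Zero E := ⟨1⟩
  let _ : Neg E := ⟨fun x => x⁻¹⟩
  let _ : AddCommGroup E :=
    { add_assoc := by
        intro x y z
        change i (t (i (t x y)⁻¹ * (x * y)) z)⁻¹ * (i (t x y)⁻¹ * (x * y) * z) =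
          i (t x (i (t y z)⁻¹ * (y * z)))⁻¹ * (x * (i (t y z)⁻¹ * (y * z)))
        rw [htl, htr, ← mul_assoc x (i _), ← hc]
        simp only [← mul_assoc, ← map_mul]
        congr 4
        simp only [map_mul (t x), mul_inv]
        rw [mul_comm, mul_assoc]
      zero_add := by
        intro x
        change i (t 1 x)⁻¹ * (1 * x) = x
        simp
      add_zero := by
        intro x
        change i (t x 1)⁻¹ * (x * 1) = x
        simp
      nsmul := nsmulRec
      zsmul := zsmulRec
      neg_add_cancel := by
        intro x
        change i (t x⁻¹ x)⁻¹ * (x⁻¹ * x) = 1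
        simp [htt]
      add_comm := by
        intro x y
        change i (t x y)⁻¹ * (x * y) = i (t y x)⁻¹ * (y * x)
        rw [ht x y, ← mul_assoc, ← map_mul, ← eq_inv_of_mul_eq_one_left (hskew x y)]
        simp [pow_two] }
  have hadd : ∀ x y : E, x + y = i (t x y)⁻¹ * (x * y) := fun _ _ => rfl
  let f : Additive K →+ E :=
    { toFun := fun c => i c.toMul
      map_zero' := map_one i
      map_add' := fun c d => by simp [hadd, hti] }
  -- Divisible groups are injective, so the identity of `K` extends to the new additive group.
  obtain ⟨h, hh⟩ := (Module.Baer.of_divisible (Additive K)).extension_property_addMonoidHom f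
    (fun c d hcd => hi hcd) (AddMonoidHom.id _)
  have hr : ∀ c, (h (i c)).toMul = c := fun c => DFunLike.congr_fun hh (Additive.ofMul c)
  refine ⟨fun x => (h x).toMul, fun x y => ?_, hr⟩
  have h1 : x * y = i (t x y) + (x + y) := by
    rw [hadd, hti, hadd, ← mul_assoc, ← mul_assoc, ← map_mul, ← map_mul]
    simp
  change (h (x * y)).toMul = t x y * (h x + h y).toMul
  rw [h1, map_add h, map_add h, toMul_add, hr]

/-- In a group with a normal subgroup `E` that is a central extension by a divisible group `K`,
whose commutator pairing `w` has odd exponent and represents every character of `E` trivial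
on `K`, there is a subgroup supplementing `E` which meets `E` in the radical of `w`. -/
theorem exists_supplement_of_pairing {Γ K : Type*} [Group Γ] [CommGroup K]
    [DivisibleBy (Additive K) ℤ] (E : Subgroup Γ) [E.Normal] (i : K →* E)
    (hi : Function.Injective i) (hc : ∀ c (g : Γ), g * i c = i c * g) (w : E →* E →* K)
    (hw : ∀ x y, x * y = i (w x y) * (y * x)) (s : ℕ) (hs : ∀ x y, w x y ^ (2 * s) = w x y)
    (hsurj : ∀ χ : E →* K, (∀ c, χ (i c) = 1) → ∃ y, w y = χ) :
    ∃ M : Subgroup Γ, M ⊔ E = ⊤ ∧ ∀ x : E, (x : Γ) ∈ M → w x = 1 := by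
  have hcE : ∀ c (x : E), i c * x = x * i c := fun c x => Subtype.ext (hc c x).symm
  have huniq : ∀ (x y : E) c, x * y = i c * (y * x) → w x y = c := by
    intro x y c h
    exact hi (mul_right_cancel ((hw x y).symm.trans h))
  have hwi : ∀ c x, w (i c) x = 1 := fun c x => huniq _ _ _ (by rw [hcE]; simp)
  have hwx : ∀ x, w x x = 1 := fun x => huniq _ _ _ (by simp)
  -- By `hs`, `t` is a square root of `w`.
  let t : E →* E →* K := (powMonoidHom s).comp w
  have htdef : ∀ x y, t x y = w x y ^ s := fun _ _ => rfl
  obtain ⟨r, hr, hri⟩ := exists_twisted_retraction i hi hcE t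
    (fun x y => by rw [htdef, ← pow_mul, mul_comm s, hs]; exact hw x y)
    (fun x => by simp [htdef, hwx]) (fun c x => by simp [htdef, hwi])
  have hric : ∀ c x, r (i c * x) = c * r x := by
    intro c x
    rw [hr, hri, htdef, hwi, one_pow, one_mul]
  have hconj : ∀ x y : E, MulAut.conjNormal (x : Γ) y = i (w x y) * y := by
    intro x y
    apply Subtype.ext
    have := congrArg Subtype.val (hw x y)
    simp only [Subgroup.coe_mul] at this
    rw [MulAut.conjNormal_apply, this]
    simp [mul_assoc]
  have hconji : ∀ (g : Γ) c, MulAut.conjNormal g (i c) = i c := by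
    intro g c
    apply Subtype.ext
    rw [MulAut.conjNormal_apply, hc]
    simp
  have hrconj : ∀ x y : E, r (MulAut.conjNormal (x : Γ) y) = w x y * r y := by
    intro x y
    rw [hconj, hric]
  have hwconj : ∀ (g : Γ) (x y : E),
      w (MulAut.conjNormal g x) (MulAut.conjNormal g y) = w x y := by
    intro g x y
    apply huniq
    rw [← map_mul, hw x y, map_mul, hconji, map_mul]
  -- `M` is the stabilizer of `r` under conjugation. By `hrconj`, an element `x` of `E` multiplies
  -- `r` by `w x`, so `M` meets `E` in the radical.
  let M : Subgroup Γ :=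
    { carrier := {g | ∀ x : E, r (MulAut.conjNormal g x) = r x}
      one_mem' := fun x => by simp
      mul_mem' := fun {a b} ha hb x => by
        rw [map_mul, MulAut.mul_apply, ha, hb]
      inv_mem' := fun {a} ha x => by
        rw [← ha, ← MulAut.mul_apply, ← map_mul]
        simp }
  have hM : ∀ g, g ∈ M ↔ ∀ x : E, r (MulAut.conjNormal g x) = r x := fun _ => Iff.rfl
  refine ⟨M, ?_, ?_⟩
  · rw [eq_top_iff]
    intro g _
    -- Conjugation by `g` preserves `t`, so it turns `r` into another twisted retraction; the two
    -- differ by a genuine character `w y`, and dividing `g` by `y` restores `r`.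
    let χ : E →* K := MonoidHom.mk' (fun x => r (MulAut.conjNormal g x) * (r x)⁻¹) (by
      intro x y
      rw [map_mul, hr, hr, htdef, htdef, hwconj]
      simp only [mul_inv]
      rw [mul_mul_mul_comm, mul_inv_cancel, one_mul, mul_mul_mul_comm])
    have hχ : ∀ x, r (MulAut.conjNormal g x) = χ x * r x := fun x => by
      simp [χ]
    obtain ⟨y, hy⟩ := hsurj χ (fun c => by simp [χ, hconji])
    have hgy : g * (y : Γ)⁻¹ ∈ M := by
      rw [hM]
      intro x
      rw [map_mul, MulAut.mul_apply, hχ, ← hy, ← hrconj, ← MulAut.mul_apply, ← map_mul]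
      simp
    have := Subgroup.mul_mem_sup hgy y.2
    simpa using this
  · intro x hx
    ext y
    have := (hM _).1 hx y
    rw [hrconj] at this
    simpa using this

/-! ### Commutator pairings and linear independence -/

/-- The commutator pairing of an abelian subgroup with respect to a central extension. -/
theorem exists_commutator_pairing {K Γ H : Type*} [CommGroup K] [Group Γ] [Group H] (i : K →* Γ)
    (π : Γ →* H) (hi : Function.Injective i) (hπ : Function.Surjective π)
    (hker : π.ker = i.range) (hc : ∀ c g, g * i c = i c * g) (A : Subgroup H)
    (hA : ∀ a ∈ A, ∀ b ∈ A, a * b = b * a) :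
    ∃ ω : A →* A →* K, ∀ (a b : A) (x y : Γ), π x = a → π y = b →
      x * y = i (ω a b) * (y * x) := by
  have hlift : ∀ x y, π x = π y → ∃ c, x = i c * y := by
    intro x y h
    have : x * y⁻¹ ∈ π.ker := by simp [MonoidHom.mem_ker, h]
    rw [hker] at this
    obtain ⟨c, hc⟩ := this
    exact ⟨c, by simp [hc]⟩
  -- Two lifts of an element differ by a central factor, which does not affect commutators.
  have key : ∀ a b : A, ∃ c, ∀ x y, π x = a → π y = b → x * y = i c * (y * x) := by
    intro a b
    obtain ⟨x, hx⟩ := hπ a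
    obtain ⟨y, hy⟩ := hπ b
    obtain ⟨c, h⟩ := hlift (x * y) (y * x) (by
      rw [map_mul, map_mul, hx, hy, hA a a.2 b b.2])
    refine ⟨c, fun x' y' hx' hy' => ?_⟩
    obtain ⟨d, rfl⟩ := hlift x' x (hx'.trans hx.symm)
    obtain ⟨e, rfl⟩ := hlift y' y (hy'.trans hy.symm)
    calc i d * x * (i e * y) = i d * (i e * (x * y)) := by
          rw [mul_assoc, ← mul_assoc x, hc, mul_assoc]
      _ = i d * (i e * (i c * (y * x))) := by rw [h]
      _ = i c * (i e * (i d * (y * x))) := by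
          simp only [← mul_assoc, ← map_mul]
          rw [mul_comm, mul_left_comm, mul_comm d, mul_assoc]
      _ = i c * (i e * y * (i d * x)) := by
          rw [← mul_assoc (i d) y, ← hc d y, mul_assoc y, ← mul_assoc (i e) y]
  choose w hw using key
  have huniq : ∀ (a b : A) (c : K) x y, π x = a → π y = b → x * y = i c * (y * x) →
      w a b = c := by
    intro a b c x y hx hy h
    exact hi (mul_right_cancel ((hw a b x y hx hy).symm.trans h))
  refine ⟨MonoidHom.mk' (fun a => MonoidHom.mk' (w a) ?_) ?_, hw⟩
  · intro b c
    obtain ⟨x, hx⟩ := hπ a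
    obtain ⟨y, hy⟩ := hπ b
    obtain ⟨z, hz⟩ := hπ c
    refine huniq _ _ _ x (y * z) hx (by simp [hy, hz]) ?_
    rw [← mul_assoc, hw a b x y hx hy, mul_assoc, mul_assoc, hw a c x z hx hz, map_mul,
      ← mul_assoc y (i _), hc]
    simp only [mul_assoc]
  · intro a b
    ext c
    change w (a * b) c = w a c * w b c
    obtain ⟨x, hx⟩ := hπ a
    obtain ⟨y, hy⟩ := hπ b
    obtain ⟨z, hz⟩ := hπ c
    refine huniq _ _ _ (x * y) z (by simp [hx, hy]) hz ?_
    rw [mul_assoc, hw b c y z hy hz, ← mul_assoc x, hc, mul_assoc, ← mul_assoc x,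
      hw a c x z hx hz, map_mul]
    simp only [mul_assoc]
    rw [← mul_assoc (i (w b c)) (i (w a c)), hc, mul_assoc]

/-- A finite group has at most as many linear characters as elements. -/
theorem finite_and_card_monoidHom_units_le (A k : Type*) [Group A] [Finite A] [Field k] :
    Finite (A →* kˣ) ∧ Nat.card (A →* kˣ) ≤ Nat.card A := by
  have := Fintype.ofFinite A
  have hli : LinearIndependent k (fun f : A →* kˣ => fun a => (f a : k)) := by
    refine (linearIndependent_monoidHom A k).comp
      (fun f : A →* kˣ => (Units.coeHom k).comp f) ?_
    intro f g h
    ext a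
    exact DFunLike.congr_fun h a
  have : Finite (A →* kˣ) := hli.finite
  have := Fintype.ofFinite (A →* kˣ)
  refine ⟨inferInstance, ?_⟩
  have := hli.fintype_card_le_finrank
  simpa [Nat.card_eq_fintype_card] using this

/-- A nondegenerate pairing of a finite group with itself represents all linear characters. -/
theorem pairing_surjective {A k : Type*} [Group A] [Finite A] [Field k] (ω : A →* A →* kˣ)
    (h : Function.Injective ω) : Function.Surjective ω := by
  obtain ⟨_, hcard⟩ := finite_and_card_monoidHom_units_le A k
  exact (h.bijective_of_nat_card_le hcard).2

/-- Nonzero matrices which are eigenvectors with distinct characters for conjugation by each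
other are linearly independent; hence their number is at most the square of the degree. -/
theorem card_le_sq_of_pairing {A k : Type*} [Group A] [Finite A] [Field k] {m : ℕ} (hm : 0 < m)
    (ω : A →* A →* kˣ) (hω : Function.Injective ω) (L : A → Matrix.GeneralLinearGroup (Fin m) k)
    (hL : ∀ a b, (L a * L b : Matrix (Fin m) (Fin m) k) = (ω a b : k) • (L b * L a)) :
    Nat.card A ≤ m ^ 2 := by
  have := Fintype.ofFinite A
  have : Nonempty (Fin m) := ⟨⟨0, hm⟩⟩
  have hω' : ∀ x y : A, ω x y * ω y x = 1 := by
    intro x y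
    have h := hL x y
    rw [hL y x, smul_smul, ← Units.val_mul, ← Units.val_mul] at h
    have h1 := sub_eq_zero.2 h.symm
    nth_rewrite 2 [← one_smul k (L x * L y).val] at h1
    rw [← sub_smul, smul_eq_zero, or_iff_left (L x * L y).isUnit.ne_zero, sub_eq_zero] at h1
    exact Units.ext h1
  -- Skew-symmetry makes the characters `b ↦ ω b a` distinct, so Dedekind's theorem applies.
  have hli : LinearIndependent k (fun a : A => fun b => (ω b a : k)) := by
    refine (linearIndependent_monoidHom A k).comp
      (fun a : A => (Units.coeHom k).comp (ω.flip a)) ?_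
    intro a a' h
    apply hω
    ext b
    have := DFunLike.congr_fun h b
    have h2 : ω b a = ω b a' := Units.ext this
    rw [eq_inv_of_mul_eq_one_left (hω' a b), h2, ← eq_inv_of_mul_eq_one_left (hω' a' b)]
  have hli2 : LinearIndependent k (fun a => (L a : Matrix (Fin m) (Fin m) k)) := by
    rw [Fintype.linearIndependent_iff]
    intro c hc a
    -- Conjugating a linear relation by `L b` scales its `a`-th term by `ω b a`. Independence of
    -- characters, applied entry by entry, then kills every term.
    have h1 : ∀ b, ∑ a, (c a * (ω b a : k)) • (L a : Matrix (Fin m) (Fin m) k) = 0 := by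
      intro b
      have : (∑ a, (c a * (ω b a : k)) • (L a : Matrix (Fin m) (Fin m) k)) * (L b).val = 0 :=
        calc
          _ = (L b).val * ∑ a, c a • (L a : Matrix (Fin m) (Fin m) k) := by
            rw [Finset.sum_mul, Finset.mul_sum]
            refine Finset.sum_congr rfl fun a _ => ?_
            rw [Matrix.mul_smul, hL, smul_smul, smul_mul_assoc]
          _ = 0 := by rw [hc, mul_zero]
      exact (L b).isUnit.mul_left_eq_zero.1 this
    have h2 : ∀ p q, c a * (L a : Matrix (Fin m) (Fin m) k) p q = 0 := by
      intro p q
      refine Fintype.linearIndependent_iff.1 hli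
        (fun a => c a * (L a : Matrix (Fin m) (Fin m) k) p q) ?_ a
      ext b
      have := congrFun (congrFun (h1 b) p) q
      rw [Matrix.sum_apply, Matrix.zero_apply] at this
      rw [Finset.sum_apply, Pi.zero_apply, ← this]
      exact Finset.sum_congr rfl fun a _ => mul_right_comm _ _ _
    by_contra hca
    refine (L a).isUnit.ne_zero ?_
    ext p q
    exact (mul_eq_zero.1 (h2 p q)).resolve_left hca
  have := hli2.fintype_card_le_finrank
  simpa [Nat.card_eq_fintype_card, Module.finrank_matrix, pow_two] using this

/-! ### Symplectic bases and symplectic embeddings -/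

open Matrix in
/-- A nondegenerate alternating form on a finite-dimensional space has a symplectic basis. -/
theorem exists_symplectic_basis {K V : Type*} [Field K] [AddCommGroup V] [Module K V]
    [FiniteDimensional K V] (B : LinearMap.BilinForm K V) (hB : B.IsAlt)
    (hnd : ∀ x, (∀ y, B x y = 0) → x = 0) :
    ∃ (n : ℕ) (b : Module.Basis (Fin n ⊕ Fin n) K V), ∀ s t, B (b s) (b t) = J (Fin n) K s t := by
  -- A symplectic family is independent because J is invertible, so a largest one exists. If it did
  -- not span, a hyperbolic pair orthogonal to it would enlarge it.
  let P : ℕ → Prop := fun n => ∃ b : Fin n ⊕ Fin n → V, ∀ s t, B (b s) (b t) = J (Fin n) K s t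
  have hcoef : ∀ {n : ℕ} {b : Fin n ⊕ Fin n → V}, (∀ s t, B (b s) (b t) = J (Fin n) K s t) →
      ∀ (c : Fin n ⊕ Fin n → K) t, B (∑ s, c s • b s) (b t) = (c ᵥ* J (Fin n) K) t := by
    intro n b hb c t
    simp [hb, Matrix.vecMul, dotProduct]
  have hli : ∀ {n : ℕ} {b : Fin n ⊕ Fin n → V}, (∀ s t, B (b s) (b t) = J (Fin n) K s t) →
      LinearIndependent K b := by
    intro n b hb
    rw [Fintype.linearIndependent_iff]
    intro c hc s
    have h1 : c ᵥ* J (Fin n) K = 0 := by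
      ext t
      rw [← hcoef hb, hc]
      simp
    have h2 := congrArg (fun v => v ᵥ* J (Fin n) K) h1
    simp only [Matrix.vecMul_vecMul, Matrix.J_squared, Matrix.zero_vecMul, Matrix.vecMul_neg,
      Matrix.vecMul_one] at h2
    simpa using congrFun h2 s
  have hbound : ∀ n, P n → n ≤ Module.finrank K V := by
    rintro n ⟨b, hb⟩
    have := (hli hb).fintype_card_le_finrank
    simp at this
    omega
  have h0 : P 0 := ⟨fun s => 0, fun s => by rcases s with s | s <;> exact s.elim0⟩
  classical
  have hmax := Nat.findGreatest_spec (P := P) (Nat.zero_le (Module.finrank K V)) h0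
  set n := Nat.findGreatest P (Module.finrank K V)
  obtain ⟨b, hb⟩ := hmax
  have hperp : ∀ v, ∃ u ∈ Submodule.span K (Set.range b), ∀ t, B (v - u) (b t) = 0 := by
    intro v
    -- The coefficients of the projection solve c J = B(v, b ·), using J² = -1.
    refine ⟨∑ s, (-((fun t => B v (b t)) ᵥ* J (Fin n) K)) s • b s,
      Submodule.sum_mem _ fun s _ => Submodule.smul_mem _ _ (Submodule.subset_span ⟨s, rfl⟩), ?_⟩
    intro t
    rw [map_sub, LinearMap.sub_apply, hcoef hb, Matrix.neg_vecMul, Matrix.vecMul_vecMul,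
      Matrix.J_squared, Matrix.vecMul_neg, Matrix.vecMul_one]
    simp
  have hspan : ⊤ ≤ Submodule.span K (Set.range b) := by
    intro v _
    by_contra hv
    obtain ⟨u, hu, hvu⟩ := hperp v
    have hv0 : v - u ≠ 0 := fun h => hv (by rwa [sub_eq_zero.1 h])
    obtain ⟨y, hy⟩ : ∃ y, B (v - u) y ≠ 0 := by
      by_contra! h
      exact hv0 (hnd _ h)
    obtain ⟨z, hz, hyz⟩ := hperp y
    set x := v - u
    have hxz : B x z = 0 := by
      clear hyz
      induction hz using Submodule.span_induction with
      | mem z hz => obtain ⟨t, rfl⟩ := hz; exact hvu t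
      | zero => simp
      | add a c _ _ ha hc => simp [ha, hc]
      | smul a c _ hc => simp [hc]
    -- The scaling gives B(x, w) = -1, the sign of the upper right block of J.
    set w := -(B x y)⁻¹ • (y - z)
    have hxw : B x w = -1 := by simp [w, hxz, hy]
    have hwx : B w x = 1 := by rw [← hB.neg_eq, hxw, neg_neg]
    have hwb : ∀ t, B w (b t) = 0 := fun t => by
      simp only [w, map_smul, LinearMap.smul_apply, hyz, smul_zero]
    have hbx : ∀ t, B (b t) x = 0 := fun t => by rw [← hB.neg_eq, hvu, neg_zero]
    have hbw : ∀ t, B (b t) w = 0 := fun t => by rw [← hB.neg_eq, hwb, neg_zero]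
    have hxx : B x x = 0 := hB x
    have hww : B w w = 0 := hB w
    have hsucc : P (n + 1) := by
      refine ⟨Sum.elim (Fin.cons x (b ∘ Sum.inl)) (Fin.cons w (b ∘ Sum.inr)), ?_⟩
      rintro (s | s) (t | t) <;> refine Fin.cases ?_ (fun s => ?_) s <;>
        refine Fin.cases ?_ (fun t => ?_) t <;>
        simp [J, hvu, hxw, hwx, hwb, hbx, hbw, hxx, hww, hb, Matrix.one_apply, Fin.succ_ne_zero,
          (Fin.succ_ne_zero _).symm]
    have := Nat.le_findGreatest (hbound _ hsucc) hsucc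
    change n + 1 ≤ n at this
    omega
  exact ⟨n, Module.Basis.mk (hli hb) hspan, by simpa using hb⟩

open Matrix in
/-- A faithful irreducible representation over `𝔽₂` preserving a nondegenerate alternating form
gives an irreducible embedding in a symplectic group. -/
theorem exists_embedsIrreduciblyInSp {G V : Type*} [Group G] [AddCommGroup V] [Module (ZMod 2) V]
    [FiniteDimensional (ZMod 2) V] [Nontrivial V] (σ : Representation (ZMod 2) G V)
    (hσ : Function.Injective σ)
    (hirr : ∀ W : Submodule (ZMod 2) V, (∀ g, ∀ v ∈ W, σ g v ∈ W) → W = ⊥ ∨ W = ⊤)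
    (B : LinearMap.BilinForm (ZMod 2) V) (hB : B.IsAlt) (hnd : ∀ x, (∀ y, B x y = 0) → x = 0)
    (hinv : ∀ g x y, B (σ g x) (σ g y) = B x y) :
    ∃ n, Module.finrank (ZMod 2) V = 2 * n ∧ EmbedsIrreduciblyInSp G n := by
  obtain ⟨n, b, hb⟩ := exists_symplectic_basis B hB hnd
  refine ⟨n, by rw [Module.finrank_eq_card_basis b]; simp; omega, ?_⟩
  have hBJ : LinearMap.BilinForm.toMatrix b B = J (Fin n) (ZMod 2) := by
    ext s t
    rw [LinearMap.BilinForm.toMatrix_apply, hb]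
  let F : G →* Matrix (Fin n ⊕ Fin n) (Fin n ⊕ Fin n) (ZMod 2) :=
    (LinearMap.toMatrixAlgEquiv b).toAlgHom.toMonoidHom.comp σ
  have hF : ∀ g, F g ∈ symplecticGroup (Fin n) (ZMod 2) := by
    intro g
    rw [SymplecticGroup.mem_iff', ← hBJ]
    change (LinearMap.toMatrix b b (σ g))ᵀ * _ * LinearMap.toMatrix b b (σ g) = _
    rw [← LinearMap.BilinForm.toMatrix_comp]
    congr 1
    ext x y
    exact hinv g x y
  let f := F.codRestrict (symplecticGroup (Fin n) (ZMod 2)) hF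
  -- Coordinates intertwine the matrix action with `σ`, so irreducibility transfers.
  have hrep : ∀ g c, b.equivFun.symm (symplecticRep f g c) = σ g (b.equivFun.symm c) := by
    intro g c
    rw [LinearEquiv.symm_apply_eq]
    change (LinearMap.toMatrix b b (σ g)) *ᵥ c = _
    have := LinearMap.toMatrix_mulVec_repr b b (σ g) (b.equivFun.symm c)
    have h2 : ⇑(b.repr (b.equivFun.symm c)) = c := b.equivFun.apply_symm_apply c
    rw [h2] at this
    exact this
  refine ⟨f, ?_, ?_⟩
  · intro g h hgh
    apply hσ
    have : F g = F h := congrArg Subtype.val hgh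
    exact (LinearMap.toMatrixAlgEquiv b).injective this
  · have : Nontrivial (Fin n ⊕ Fin n → ZMod 2) := b.equivFun.symm.toEquiv.nontrivial
    refine
      { exists_pair_ne := ⟨⊥, ⊤, fun h => ?_⟩
        eq_bot_or_eq_top := fun W => ?_ }
    · exact bot_ne_top (α := Submodule (ZMod 2) (Fin n ⊕ Fin n → ZMod 2))
        (congrArg Subrepresentation.toSubmodule h)
    · have h1 := hirr (W.toSubmodule.map b.equivFun.symm.toLinearMap) (by
        rintro g _ ⟨c, hc, rfl⟩
        exact ⟨_, W.apply_mem_toSubmodule g hc, hrep g c⟩)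
      refine h1.imp (fun h => Subrepresentation.toSubmodule_injective ?_)
        (fun h => Subrepresentation.toSubmodule_injective ?_)
      · exact (Submodule.map_eq_bot_iff (e := b.equivFun.symm)).1 h
      · exact (Submodule.map_eq_top_iff (e := b.equivFun.symm)).1 h

/-! ### Joint eigenspaces and primitivity -/

open Matrix in
/-- The simultaneous eigenspace of a family of invertible matrices. -/
def jointEigenspace {m : ℕ} {k : Type*} [Field k]
    {S : Subgroup (Matrix.GeneralLinearGroup (Fin m) k)} (χ : S → k) :
    Submodule k (Fin m → k) where
  carrier := {v | ∀ x : S, x.1.val *ᵥ v = χ x • v}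
  zero_mem' := fun x => by simp
  add_mem' := fun {v w} hv hw x => by
    rw [Matrix.mulVec_add, hv x, hw x, smul_add]
  smul_mem' := fun c v hv x => by
    rw [Matrix.mulVec_smul, hv x, smul_comm]

open Matrix in
/-- Commuting invertible matrices over an algebraically closed field have a common eigenvector. -/
theorem exists_jointEigenspace_ne_bot {m : ℕ} {k : Type*} [Field k] [IsAlgClosed k] (hm : 0 < m)
    (S : Subgroup (Matrix.GeneralLinearGroup (Fin m) k))
    (hS : ∀ x ∈ S, ∀ y ∈ S, x * y = y * x) :
    ∃ χ : S → k, jointEigenspace χ ≠ ⊥ := by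
  have : Nonempty (Fin m) := ⟨⟨0, hm⟩⟩
  -- On a minimal nonzero invariant `W`, an eigenspace of any `x` is again invariant by
  -- commutativity, so it is all of `W`.
  obtain ⟨W, ⟨hW0, hW⟩, hmin⟩ := WellFounded.has_min
    (wellFounded_lt (α := Submodule k (Fin m → k)))
    {W | W ≠ ⊥ ∧ ∀ x ∈ S, ∀ v ∈ W, x.val *ᵥ v ∈ W} ⟨⊤, top_ne_bot, by simp⟩
  have key : ∀ x : S, ∃ c : k, ∀ v ∈ W, x.1.val *ᵥ v = c • v := by
    intro x
    let f : Module.End k W := (Matrix.toLin' x.1.val).restrict (fun v hv => by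
      simpa using hW x x.2 v hv)
    have : Nontrivial W := Submodule.nontrivial_iff_ne_bot.2 hW0
    obtain ⟨c, hc⟩ := Module.End.exists_eigenvalue f
    obtain ⟨u, hu⟩ := hc.exists_hasEigenvector
    have hfu : x.1.val *ᵥ (u : Fin m → k) = c • (u : Fin m → k) := by
      have := congrArg Subtype.val hu.apply_eq_smul
      simpa [f] using this
    let W' : Submodule k (Fin m → k) := W ⊓ LinearMap.ker (Matrix.toLin' x.1.val - c • 1)
    have hmem : ∀ v, v ∈ W' ↔ v ∈ W ∧ x.1.val *ᵥ v = c • v := fun v => by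
      simp [W', sub_eq_zero]
    refine ⟨c, fun v hv => ?_⟩
    have hle : W' ≤ W := inf_le_left
    have heq : W' = W := by
      by_contra hne
      refine hmin W' ⟨fun h => ?_, ?_⟩ (lt_of_le_of_ne hle hne)
      · have : (u : Fin m → k) ∈ W' := (hmem _).2 ⟨u.2, hfu⟩
        rw [h, Submodule.mem_bot] at this
        exact hu.2 (Subtype.ext this)
      · intro y hy v hv
        rw [hmem] at hv ⊢
        refine ⟨hW y hy v hv.1, ?_⟩
        have hxy : x.1.val * y.val = y.val * x.1.val := congrArg Units.val (hS x x.2 y hy)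
        rw [Matrix.mulVec_mulVec, hxy, ← Matrix.mulVec_mulVec, hv.2, Matrix.mulVec_smul]
    rw [← heq] at hv
    exact ((hmem v).1 hv).2
  choose χ hχ using key
  refine ⟨χ, fun h => hW0 (eq_bot_iff.2 fun v hv => ?_)⟩
  rw [← h]
  exact fun x => hχ x v hv

-- Joint eigenspaces lie in the intersections of maximal generalized eigenspaces, which are
-- independent for commuting operators.
open Matrix in
theorem iSupIndep_jointEigenspace {m : ℕ} {k : Type*} [Field k]
    (S : Subgroup (Matrix.GeneralLinearGroup (Fin m) k))
    (hS : ∀ x ∈ S, ∀ y ∈ S, x * y = y * x) :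
    iSupIndep (fun χ : S → k => jointEigenspace χ) := by
  refine (Module.End.independent_iInf_maxGenEigenspace_of_forall_mapsTo
    (fun x : S => (Matrix.toLin' x.1.val : Module.End k (Fin m → k))) ?_).mono ?_
  · intro x y c
    apply Module.End.mapsTo_maxGenEigenspace_of_comm
    change Matrix.toLin' _ * Matrix.toLin' _ = Matrix.toLin' _ * Matrix.toLin' _
    rw [Module.End.mul_eq_comp, Module.End.mul_eq_comp, ← Matrix.toLin'_mul, ← Matrix.toLin'_mul]
    exact congrArg Matrix.toLin' (congrArg Units.val (hS y y.2 x x.2))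
  · intro χ
    refine le_iInf fun x v hv => ?_
    refine Module.End.mem_maxGenEigenspace _ _ _ |>.2 ⟨1, ?_⟩
    have := hv x
    simp [this]

namespace ProjRep

variable {H k : Type*} [Group H] [Field k] {m : ℕ}

theorem translate_one (W : Submodule k (Fin m → k)) : translate 1 W = W := by
  simp [translate]

theorem translate_mul (g h : Matrix.GeneralLinearGroup (Fin m) k)
    (W : Submodule k (Fin m → k)) : translate (g * h) W = translate g (translate h W) := by
  simp [translate, Matrix.toLin'_mul, Submodule.map_comp]

theorem translate_mono (g : Matrix.GeneralLinearGroup (Fin m) k)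
    {W W' : Submodule k (Fin m → k)} (h : W ≤ W') : translate g W ≤ translate g W' :=
  Submodule.map_mono h

theorem translate_bot (g : Matrix.GeneralLinearGroup (Fin m) k) :
    translate g (⊥ : Submodule k (Fin m → k)) = ⊥ :=
  Submodule.map_bot _

/-- A primitive projective representation is trivial on abelian normal subgroups of the lifted
group: they consist of scalars. -/
theorem IsPrimitive.scalar_of_commute [IsAlgClosed k]
    {ρ : H →* Matrix.ProjGenLinGroup (Fin m) k} (hρ : IsPrimitive ρ)
    (S : Subgroup (Matrix.GeneralLinearGroup (Fin m) k))
    (hS : ∀ x ∈ S, ∀ y ∈ S, x * y = y * x)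
    (hconj : ∀ g ∈ preimage ρ, ∀ x ∈ S, g * x * g⁻¹ ∈ S) :
    ∀ x ∈ S, ∃ c : k, x.val = Matrix.scalar (Fin m) c := by
  obtain ⟨⟨hm, hirr⟩, hprim⟩ := hρ
  obtain ⟨χ₀, hχ₀⟩ := exists_jointEigenspace_ne_bot hm S hS
  have hconj' : ∀ g ∈ preimage ρ, ∀ x ∈ S, g⁻¹ * x * g ∈ S := fun g hg x hx => by
    simpa using hconj g⁻¹ (inv_mem hg) x hx
  -- The preimage of the image of ρ acts on eigencharacters by conjugation and permutes the joint
  -- eigenspaces accordingly.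
  let tw : preimage ρ → (S → k) → (S → k) := fun g χ x => χ ⟨_, hconj' g g.2 x x.2⟩
  have htw_inv : ∀ g χ, tw g⁻¹ (tw g χ) = χ := by
    intro g χ
    ext x
    simp only [tw]
    congr 1
    ext1
    simp [mul_assoc]
  have htw_le : ∀ (g : preimage ρ) χ,
      translate g.1 (jointEigenspace χ) ≤ jointEigenspace (tw g χ) := by
    rintro g χ _ ⟨v, hv, rfl⟩ x
    have := hv ⟨_, hconj' g g.2 x x.2⟩
    rw [Matrix.toLin'_apply, Matrix.mulVec_mulVec, ← Matrix.mulVec_smul]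
    have h2 : x.1.val * g.1.val = g.1.val * (g.1⁻¹ * x.1 * g.1).val := by
      rw [← Units.val_mul, ← Units.val_mul]
      congr 1
      simp [mul_assoc]
    rw [h2, ← Matrix.mulVec_mulVec]
    exact congrArg _ this
  have htw : ∀ (g : preimage ρ) χ,
      translate g.1 (jointEigenspace χ) = jointEigenspace (tw g χ) := by
    intro g χ
    refine le_antisymm (htw_le g χ) ?_
    have := translate_mono g.1 (htw_le g⁻¹ (tw g χ))
    rw [htw_inv, ← translate_mul] at this
    simpa [translate_one] using this
  -- The sum of the joint eigenspaces is invariant and nonzero, so irreducibility makes it the whole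
  -- space.
  have htop : ⨆ χ : S → k, jointEigenspace χ = ⊤ := by
    have hle : ∀ g ∈ preimage ρ, translate g (⨆ χ : S → k, jointEigenspace χ) ≤
        ⨆ χ : S → k, jointEigenspace χ := by
      intro g hg
      rw [translate, Submodule.map_iSup]
      exact iSup_le fun χ => (htw_le ⟨g, hg⟩ χ).trans (le_iSup _ _)
    refine (hirr _ fun g hg => le_antisymm (hle g hg) ?_).resolve_left fun h => hχ₀ ?_
    · have := translate_mono g (hle g⁻¹ (inv_mem hg))
      rw [← translate_mul] at this
      simpa [translate_one] using this
    · exact eq_bot_iff.2 (h ▸ le_iSup (fun χ : S → k => jointEigenspace χ) χ₀)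
  let ι := {χ : S → k // jointEigenspace χ ≠ ⊥}
  have hind := iSupIndep_jointEigenspace S hS
  have : Finite ι := WellFoundedGT.finite_ne_bot_of_iSupIndep hind
  have htopι : ⨆ χ : ι, jointEigenspace χ.1 = ⊤ := by
    rw [← htop]
    exact iSup_ne_bot_subtype (fun χ : S → k => jointEigenspace χ)
  -- Two nonzero joint eigenspaces would give a system of imprimitivity.
  have hsub : Subsingleton ι := by
    by_contra hns
    rw [not_subsingleton_iff_nontrivial] at hns
    refine hprim ⟨Nat.card ι, fun j => jointEigenspace ((Finite.equivFin ι).symm j).1,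
      Finite.one_lt_card, fun j => ((Finite.equivFin ι).symm j).2, ?_, ?_⟩
    · rw [DirectSum.isInternal_submodule_iff_iSupIndep_and_iSup_eq_top]
      refine ⟨hind.comp (Subtype.val_injective.comp (Finite.equivFin ι).symm.injective), ?_⟩
      rw [← htopι]
      exact (Finite.equivFin ι).symm.iSup_comp (g := fun χ : ι => jointEigenspace χ.1)
    · intro g hg
      have hne : ∀ (g : preimage ρ) (χ : ι), jointEigenspace (tw g χ.1) ≠ ⊥ := by
        intro g χ h
        apply χ.2
        have := congrArg (translate g.1⁻¹) ((htw g χ.1).trans h)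
        rwa [← translate_mul, inv_mul_cancel, translate_one, translate_bot] at this
      let σ : Equiv.Perm ι :=
        { toFun := fun χ => ⟨tw ⟨g, hg⟩ χ.1, hne _ χ⟩
          invFun := fun χ => ⟨tw ⟨g, hg⟩⁻¹ χ.1, hne _ χ⟩
          left_inv := fun χ => Subtype.ext (htw_inv _ _)
          right_inv := fun χ => Subtype.ext (by
            simpa using htw_inv (⟨g, hg⟩ : preimage ρ)⁻¹ χ.1) }
      refine ⟨((Finite.equivFin ι).symm.trans σ).trans (Finite.equivFin ι), fun j => ?_⟩
      rw [htw ⟨g, hg⟩]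
      simp [σ]
  have h0 : jointEigenspace χ₀ = ⊤ := by
    rw [eq_top_iff, ← htopι]
    refine iSup_le fun χ => ?_
    rw [show χ = ⟨χ₀, hχ₀⟩ from Subsingleton.elim _ _]
  intro x hx
  refine ⟨χ₀ ⟨x, hx⟩, ?_⟩
  apply Matrix.toLin'.injective
  ext1 j
  ext1
  have : ∀ v, x.val.mulVec v = χ₀ ⟨x, hx⟩ • v := fun v =>
    (h0 ▸ Submodule.mem_top : v ∈ jointEigenspace χ₀) ⟨x, hx⟩
  simp [-Matrix.mulVec_single, this]

end ProjRep

/-! ### Invariance of the pairing and the odd case -/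

/-- The commutator pairing is invariant under conjugation. -/
theorem pairing_conjNormal {K Γ H : Type*} [CommGroup K] [Group Γ] [Group H] {i : K →* Γ}
    {π : Γ →* H} (hi : Function.Injective i) (hπ : Function.Surjective π)
    (hc : ∀ c g, g * i c = i c * g) {A : Subgroup H} [A.Normal] {ω : A →* A →* K}
    (hω : ∀ (a b : A) (x y : Γ), π x = a → π y = b → x * y = i (ω a b) * (y * x))
    (h : H) (a b : A) : ω (MulAut.conjNormal h a) (MulAut.conjNormal h b) = ω a b := by
  obtain ⟨g, rfl⟩ := hπ h
  obtain ⟨x, hx⟩ := hπ a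
  obtain ⟨y, hy⟩ := hπ b
  have h1 := hω (MulAut.conjNormal (π g) a) (MulAut.conjNormal (π g) b) (g * x * g⁻¹)
    (g * y * g⁻¹) (by simp [MulAut.conjNormal_apply, hx]) (by simp [MulAut.conjNormal_apply, hy])
  have h2 := hω a b x y hx hy
  apply hi
  have h3 : g * (x * y) * g⁻¹ = i (ω (MulAut.conjNormal (π g) a) (MulAut.conjNormal (π g) b)) *
      (g * (y * x) * g⁻¹) := by
    simpa [mul_assoc] using h1
  rw [h2, ← mul_assoc g, hc, mul_assoc, mul_assoc, ← mul_assoc g] at h3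
  exact (mul_right_cancel h3).symm

theorem pairing_self {K Γ H : Type*} [CommGroup K] [Group Γ] [Group H] {i : K →* Γ}
    {π : Γ →* H} (hi : Function.Injective i) (hπ : Function.Surjective π)
    {A : Subgroup H} {ω : A →* A →* K}
    (hω : ∀ (a b : A) (x y : Γ), π x = a → π y = b → x * y = i (ω a b) * (y * x)) (a : A) :
    ω a a = 1 := by
  obtain ⟨x, hx⟩ := hπ a
  apply hi
  have := hω a a x x hx hx
  rw [map_one]
  exact right_eq_mul.1 this

/-- A normal subgroup of odd exponent whose commutator pairing is perfect has a complement. -/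
theorem exists_complement_of_odd {K Γ H : Type*} [CommGroup K] [DivisibleBy (Additive K) ℤ]
    [Group Γ] [Group H] (i : K →* Γ) (π : Γ →* H) (hi : Function.Injective i)
    (hπ : Function.Surjective π) (hker : π.ker = i.range) (hc : ∀ c g, g * i c = i c * g)
    (A : Subgroup H) [A.Normal] (ω : A →* A →* K)
    (hω : ∀ (a b : A) (x y : Γ), π x = a → π y = b → x * y = i (ω a b) * (y * x))
    (hinj : Function.Injective ω) (hsurj : Function.Surjective ω) (p : ℕ) (hp : Odd p)
    (hexp : ∀ a ∈ A, a ^ p = 1) : ∃ M : Subgroup H, M ⊔ A = ⊤ ∧ M ⊓ A = ⊥ := by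
  have hπi : ∀ c, π (i c) = 1 := fun c => by
    rw [← MonoidHom.mem_ker, hker]
    exact ⟨c, rfl⟩
  let j : K →* A.comap π := i.codRestrict _ fun c => by simp [hπi, one_mem]
  let φ : A.comap π →* A := π.subgroupComap A
  have hφ : Function.Surjective φ := π.subgroupComap_surjective_of_surjective A hπ
  let w : A.comap π →* A.comap π →* K := (MonoidHom.compHom' φ).comp (ω.comp φ)
  have hwdef : ∀ x y, w x y = ω (φ x) (φ y) := fun _ _ => rfl
  -- With p = 2q + 1, the exponent q + 1 inverts 2 modulo p.
  obtain ⟨q, rfl⟩ := hp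
  obtain ⟨M, hM, hMw⟩ := exists_supplement_of_pairing (A.comap π) j
    (fun c d h => hi (congrArg Subtype.val h)) hc w
    (fun x y => Subtype.ext (hω (φ x) (φ y) x y rfl rfl)) (q + 1)
    (fun x y => by
      rw [show 2 * (q + 1) = 2 * q + 1 + 1 by ring, pow_succ, hwdef, ← MonoidHom.pow_apply,
        ← map_pow, show φ x ^ (2 * q + 1) = 1 from Subtype.ext (hexp _ (φ x).2)]
      simp)
    (fun χ hχ => by
      -- A character trivial on scalars factors through `A`, where it is some `ω a`.
      have hle : φ.ker ≤ χ.ker := by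
        intro x hx
        have h1 : (x : Γ) ∈ π.ker := congrArg Subtype.val hx
        rw [hker] at h1
        obtain ⟨c, h⟩ := h1
        rw [MonoidHom.mem_ker, ← show j c = x from Subtype.ext h, hχ]
      obtain ⟨a, ha⟩ := hsurj (φ.liftOfSurjective hφ ⟨χ, hle⟩)
      obtain ⟨y, rfl⟩ := hφ a
      refine ⟨y, ?_⟩
      ext x
      rw [hwdef, ha]
      exact φ.liftOfRightInverse_comp_apply _ _ ⟨χ, hle⟩ x)
  refine ⟨M.map π, ?_, ?_⟩
  · have := congrArg (Subgroup.map π) hM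
    rwa [Subgroup.map_sup, Subgroup.map_comap_eq_self_of_surjective hπ,
      Subgroup.map_top_of_surjective π hπ] at this
  · rw [eq_bot_iff]
    rintro _ ⟨⟨g, hg, rfl⟩, hgA⟩
    have h1 := hMw ⟨g, hgA⟩ hg
    have h2 : ω ⟨π g, hgA⟩ = 1 := by
      ext b
      obtain ⟨y, rfl⟩ := hφ b
      exact DFunLike.congr_fun h1 y
    have h3 := hinj (h2.trans (map_one ω).symm)
    exact congrArg Subtype.val h3

/-! ### Structure of minimal extensions -/

/-- A minimal abelian normal subgroup of a finite group has prime exponent. -/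
theorem exists_prime_exponent {H : Type*} [Group H] [Finite H] (A : Subgroup H) [hAn : A.Normal]
    (hA : ∀ a ∈ A, ∀ b ∈ A, a * b = b * a) (hA0 : A ≠ ⊥)
    (hmin : ∀ B : Subgroup H, B.Normal → B ≤ A → B = ⊥ ∨ B = A) :
    ∃ p, p.Prime ∧ ∀ a ∈ A, a ^ p = 1 := by
  obtain ⟨p, hp, hdvd⟩ := Nat.exists_prime_and_dvd (n := Nat.card A) fun h =>
    hA0 (Subgroup.card_eq_one.1 h)
  have := Fact.mk hp
  obtain ⟨x, hx⟩ := exists_prime_orderOf_dvd_card' p hdvd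
  -- The elements of `A` killed by p form a normal subgroup, nontrivial by Cauchy's theorem.
  let B : Subgroup H :=
    { carrier := {a | a ∈ A ∧ a ^ p = 1}
      one_mem' := ⟨one_mem _, one_pow _⟩
      mul_mem' := fun {a b} ha hb => ⟨mul_mem ha.1 hb.1, by
        rw [(show Commute a b from hA a ha.1 b hb.1).mul_pow, ha.2, hb.2, one_mul]⟩
      inv_mem' := fun {a} ha => ⟨inv_mem ha.1, by rw [inv_pow, ha.2, inv_one]⟩ }
  have hB : ∀ a, a ∈ B ↔ a ∈ A ∧ a ^ p = 1 := fun _ => Iff.rfl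
  refine ⟨p, hp, fun a ha => ?_⟩
  have hBA : B = A := by
    refine (hmin B ⟨fun a ha g => ?_⟩ fun a ha => ha.1).resolve_left fun h => ?_
    · exact (hB _).2 ⟨hAn.conj_mem a ha.1 g, by rw [conj_pow, ha.2]; simp⟩
    · have hxB : (x : H) ∈ B := (hB _).2 ⟨x.2, by
        have := pow_orderOf_eq_one x
        rw [hx] at this
        exact congrArg Subtype.val this⟩
      rw [h, Subgroup.mem_bot] at hxB
      rw [show x = 1 from Subtype.ext hxB, orderOf_one] at hx
      exact hp.one_lt.ne hx
  rw [← hBA] at ha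
  exact ha.2

namespace IsMinimalExtension

variable {H G : Type*} [Group H] [Group G] {γ : H →* G}

theorem eq_top_of_sup_ker (hγ : IsMinimalExtension γ) {M : Subgroup H} (h : M ⊔ γ.ker = ⊤) :
    M = ⊤ := by
  by_contra hM
  refine (hγ.2 M (lt_top_iff_ne_top.2 hM)).ne ?_
  have := congrArg (Subgroup.map γ) h
  rwa [Subgroup.map_sup, (Subgroup.map_eq_bot_iff γ.ker).2 le_rfl, sup_bot_eq,
    Subgroup.map_top_of_surjective γ hγ.1] at this

/-- A maximal subgroup not containing the kernel would supplement it and so map onto `G`. -/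
theorem ker_le_frattini (hγ : IsMinimalExtension γ) : γ.ker ≤ frattini H := by
  refine le_iInf₂ fun M hM => ?_
  by_contra hle
  exact hM.1 (hγ.eq_top_of_sup_ker (hM.2 _ (left_lt_sup.2 hle)))

theorem isNilpotent_ker [Finite H] (hγ : IsMinimalExtension γ) : Group.IsNilpotent γ.ker := by
  have := frattini_nilpotent (G := H)
  refine Subgroup.isNilpotent_of_ker_le_center (Subgroup.inclusion hγ.ker_le_frattini) ?_
  rw [(MonoidHom.ker_eq_bot_iff _).2 (Subgroup.inclusion_injective _)]
  exact bot_le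

/-- The image of `M` is normal in the simple group `G`; if it is all of `G`, minimality gives `M =
⊤`. -/
theorem le_ker_or_eq_top [IsSimpleGroup G] (hγ : IsMinimalExtension γ) (M : Subgroup H)
    [hM : M.Normal] : M ≤ γ.ker ∨ M = ⊤ := by
  refine ((hM.map γ hγ.1).eq_bot_or_eq_top).imp (fun h => (Subgroup.map_eq_bot_iff M).1 h) ?_
  intro h
  by_contra hne
  exact (hγ.2 M (lt_top_iff_ne_top.2 hne)).ne h

/-- If the kernel of a minimal extension is nontrivial, it contains in its center a minimal
normal subgroup of the whole group. -/
theorem exists_minimal_normal [Finite H] (hγ : IsMinimalExtension γ) (hN : γ.ker ≠ ⊥) :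
    ∃ A : Subgroup H, A.Normal ∧ A ≤ γ.ker ∧ (∀ a ∈ A, ∀ n ∈ γ.ker, n * a = a * n) ∧ A ≠ ⊥ ∧
      ∀ B : Subgroup H, B.Normal → B ≤ A → B = ⊥ ∨ B = A := by
  have hZ : γ.ker ⊓ Subgroup.centralizer (γ.ker : Set H) ≠ ⊥ := by
    intro h
    have := hγ.isNilpotent_ker
    have : Nontrivial γ.ker := (Subgroup.nontrivial_iff_ne_bot _).2 hN
    have hcent : Subgroup.center γ.ker = ⊥ := by
      rw [eq_bot_iff]
      intro z hz
      rw [Subgroup.mem_center_iff] at hz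
      have : (z : H) ∈ γ.ker ⊓ Subgroup.centralizer (γ.ker : Set H) :=
        ⟨z.2, Subgroup.mem_centralizer_iff.2 fun n hn => congrArg Subtype.val (hz ⟨n, hn⟩)⟩
      rw [h] at this
      exact Subtype.ext this
    obtain ⟨n, hn⟩ := Group.IsNilpotent.nilpotent (G := γ.ker)
    -- With trivial center the upper central series never leaves `⊥`, contradicting nilpotency.
    have hall : ∀ n, Subgroup.upperCentralSeries γ.ker n = ⊥ := by
      intro n
      induction n with
      | zero => rfl
      | succ n ih =>
        rw [eq_bot_iff, ← hcent]
        intro x hx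
        rw [Subgroup.mem_upperCentralSeries_succ_iff, ih] at hx
        rw [Subgroup.mem_center_iff]
        intro y
        have := hx y
        rw [Subgroup.mem_bot] at this
        have h2 : x * y = y * x := by
          rw [← mul_inv_eq_one, mul_inv_rev]
          simpa [commutatorElement_def, mul_assoc] using this
        exact h2.symm
    exact bot_ne_top ((hall n).symm.trans hn)
  obtain ⟨A, ⟨hAn, hAle, hA0⟩, hmin⟩ := WellFounded.has_min
    (wellFounded_lt (α := Subgroup H))
    {A | A.Normal ∧ A ≤ γ.ker ⊓ Subgroup.centralizer (γ.ker : Set H) ∧ A ≠ ⊥}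
    ⟨_, inferInstance, le_rfl, hZ⟩
  refine ⟨A, hAn, hAle.trans inf_le_left, fun a ha n hn =>
    Subgroup.mem_centralizer_iff.1 (hAle ha).2 n hn, hA0, fun B hB hBA => ?_⟩
  by_contra! h
  exact hmin B ⟨hB, hBA.trans hAle, h.1⟩ (lt_of_le_of_ne hBA h.2)

end IsMinimalExtension

/-! ### From a pairing on a 2-group to a symplectic module -/

/-- The group of units of an algebraically closed field is divisible. -/
@[reducible]
noncomputable def unitsDivisibleBy (k : Type*) [Field k] [IsAlgClosed k] :
    DivisibleBy (Additive kˣ) ℤ :=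
  letI : RootableBy kˣ ℕ := rootableByOfPowLeftSurj _ _ fun {n} hn x => by
    obtain ⟨z, hz⟩ := IsAlgClosed.exists_pow_nat_eq (x : k) (Nat.pos_of_ne_zero hn)
    have hz0 : z ≠ 0 := by
      rintro rfl
      rw [zero_pow hn] at hz
      exact x.ne_zero hz.symm
    exact ⟨Units.mk0 z hz0, Units.ext hz⟩
  letI : RootableBy kˣ ℤ := Group.rootableByIntOfRootableByNat kˣ
  { div := fun a n => Additive.ofMul (RootableBy.root a.toMul n)
    div_zero := fun a => congrArg Additive.ofMul <| RootableBy.root_zero a.toMul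
    div_cancel := fun a hn => congrArg Additive.ofMul <| RootableBy.root_cancel a.toMul hn }

/-- The additive character of the group `{±1}`. -/
noncomputable def signToZMod {K : Type*} [CommGroup K] (u : K) : ZMod 2 :=
  open scoped Classical in if u = 1 then 0 else 1

theorem signToZMod_eq_zero {K : Type*} [CommGroup K] {u : K} : signToZMod u = 0 ↔ u = 1 := by
  unfold signToZMod
  split_ifs with h <;> simp [h]

theorem signToZMod_mul {k : Type*} [Field k] {u v : kˣ} (hu : u ^ 2 = 1) (hv : v ^ 2 = 1) :
    signToZMod (u * v) = signToZMod u + signToZMod v := by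
  have key : ∀ u : kˣ, u ^ 2 = 1 → u = 1 ∨ u = -1 := fun u hu => by
    have h0 : (u : k) ^ 2 = 1 := congrArg Units.val hu
    rcases sq_eq_one_iff.1 h0 with h | h
    · exact Or.inl (Units.ext h)
    · exact Or.inr (Units.ext h)
  by_cases h1 : (-1 : kˣ) = 1
  · rcases key u hu with rfl | rfl <;> rcases key v hv with rfl | rfl <;> simp [h1, signToZMod]
  · rcases key u hu with rfl | rfl <;> rcases key v hv with rfl | rfl <;> simp [h1, signToZMod]
    decide

/-- If `N` is the kernel of a surjection `H → G` and `A` is an elementary abelian minimal normal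
`2`-subgroup with centralizer `N` carrying a nondegenerate invariant alternating pairing,
then `G` embeds irreducibly in a symplectic group over `𝔽₂`. -/
theorem exists_embedsIrreduciblyInSp_of_pairing {H G k : Type*} [Group H] [Finite H] [Group G]
    [Field k] {γ : H →* G} (hγ : Function.Surjective γ) (A : Subgroup H) [A.Normal]
    (hA : ∀ a ∈ A, ∀ b ∈ A, a * b = b * a) (hA0 : A ≠ ⊥)
    (hmin : ∀ B : Subgroup H, B.Normal → B ≤ A → B = ⊥ ∨ B = A)
    (hker : (MulAut.conjNormal : H →* MulAut A).ker = γ.ker) (hexp : ∀ a ∈ A, a ^ 2 = 1)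
    (ω : A →* A →* kˣ) (hinj : Function.Injective ω) (hself : ∀ a, ω a a = 1)
    (hinv : ∀ h a b, ω (MulAut.conjNormal h a) (MulAut.conjNormal h b) = ω a b) :
    ∃ n, Nat.card A = 2 ^ (2 * n) ∧ EmbedsIrreduciblyInSp G n := by
  let _ : CommGroup A := { mul_comm := fun a b => Subtype.ext (hA a a.2 b b.2) }
  have hsq : ∀ a : A, a ^ 2 = 1 := fun a => Subtype.ext (hexp a a.2)
  let _ : Module (ZMod 2) (Additive A) := AddCommGroup.zmodModule hsq
  have hω2 : ∀ a b, ω a b ^ 2 = 1 := fun a b => by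
    rw [← map_pow, hsq, map_one]
  let B : LinearMap.BilinForm (ZMod 2) (Additive A) :=
    ((AddMonoidHom.mk' (fun a => (AddMonoidHom.mk'
      (fun b => signToZMod (ω a.toMul b.toMul)) fun b c => by
        rw [toMul_add, map_mul, signToZMod_mul (hω2 _ _) (hω2 _ _)]).toZModLinearMap 2)
      fun a b => by
        ext c
        change signToZMod (ω (a.toMul * b.toMul) c.toMul) = _ + _
        rw [map_mul, MonoidHom.mul_apply, signToZMod_mul (hω2 _ _) (hω2 _ _)]
        rfl).toZModLinearMap 2)
  have hB : ∀ a b, B a b = signToZMod (ω a.toMul b.toMul) := fun _ _ => rfl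
  -- Conjugation on `A` has kernel exactly `γ.ker`, so it descends to a faithful action of `G`.
  let δ : G →* MulAut A := γ.liftOfSurjective hγ ⟨MulAut.conjNormal, hker.ge⟩
  have hδ : ∀ h, δ (γ h) = MulAut.conjNormal h :=
    fun h => γ.liftOfRightInverse_comp_apply _ _ ⟨MulAut.conjNormal, hker.ge⟩ h
  let σ : Representation (ZMod 2) G (Additive A) :=
    { toFun := fun g => (MulEquiv.toAdditive (δ g)).toAddMonoidHom.toZModLinearMap 2
      map_one' := by ext; simp
      map_mul' := fun g h => by ext; simp }
  have hσ : ∀ g a, σ g a = Additive.ofMul (δ g a.toMul) := fun _ _ => rfl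
  have : Nontrivial (Additive A) := (Subgroup.nontrivial_iff_ne_bot A).2 hA0
  have : Finite (Additive A) := inferInstanceAs (Finite A)
  have : FiniteDimensional (ZMod 2) (Additive A) := Module.Finite.of_finite
  have key : ∃ n, Module.finrank (ZMod 2) (Additive A) = 2 * n ∧ EmbedsIrreduciblyInSp G n := by
    refine exists_embedsIrreduciblyInSp σ ?_ ?_ B ?_ ?_ ?_
    · intro g g' h
      obtain ⟨x, rfl⟩ := hγ g
      obtain ⟨y, rfl⟩ := hγ g'
      have h1 : (MulAut.conjNormal x : MulAut A) = MulAut.conjNormal y := by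
        rw [← hδ, ← hδ]
        ext1 a
        exact DFunLike.congr_fun h (Additive.ofMul a)
      have h2 : x * y⁻¹ ∈ γ.ker := by
        rw [← hker, MonoidHom.mem_ker, map_mul, h1, map_inv, mul_inv_cancel]
      rw [MonoidHom.mem_ker, map_mul, map_inv] at h2
      exact mul_inv_eq_one.1 h2
    · intro W hW
      -- Invariant subspaces are the normal subgroups of `H` inside `A`, so minimality of `A` is
      -- irreducibility.
      let C : Subgroup A := AddSubgroup.toSubgroup' W.toAddSubgroup
      have hC : ∀ a : A, a ∈ C ↔ Additive.ofMul a ∈ W := fun _ => Iff.rfl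
      have hn : (C.map A.subtype).Normal := by
        refine ⟨?_⟩
        rintro _ ⟨a, ha, rfl⟩ h
        refine ⟨MulAut.conjNormal h a, ?_, by simp [MulAut.conjNormal_apply]⟩
        have := hW (γ h) _ ((hC a).1 ha)
        rw [hσ, hδ] at this
        exact this
      refine (hmin _ hn (by rintro _ ⟨a, -, rfl⟩; exact a.2)).imp (fun h => ?_) (fun h => ?_)
      · rw [eq_bot_iff]
        intro a ha
        have h1 : (a.toMul : H) ∈ C.map A.subtype := ⟨a.toMul, ha, rfl⟩
        rw [h] at h1
        have h2 : a.toMul = 1 := Subtype.ext h1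
        exact h2
      · rw [eq_top_iff]
        intro a _
        obtain ⟨b, hb, hba⟩ := h.ge a.toMul.2
        rw [show a = Additive.ofMul b from (Subtype.ext hba : b = a.toMul).symm]
        exact hb
    · intro a
      rw [hB, hself, signToZMod_eq_zero]
    · intro a h
      have : ω a.toMul = 1 := by
        ext1 b
        exact signToZMod_eq_zero.1 (h (Additive.ofMul b))
      exact hinj (this.trans (map_one ω).symm)
    · intro g a b
      obtain ⟨h, rfl⟩ := hγ g
      rw [hB, hB, hσ, hσ, hδ]
      exact congrArg _ (hinv h _ _)
  obtain ⟨n, hn, hemb⟩ := key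
  refine ⟨n, ?_, hemb⟩
  have := Module.natCard_eq_pow_finrank (K := ZMod 2) (V := Additive A)
  rw [hn, Nat.card_zmod] at this
  exact this

/-! ### Lifting a faithful projective representation -/

namespace ProjRep

variable {H G k : Type*} [Group H] [Field k] {m : ℕ}

/-- A faithful projective representation makes the preimage of its image in `GL_m(k)` a central
extension of the group. -/
theorem exists_lift {ρ : H →* Matrix.ProjGenLinGroup (Fin m) k} (hρ : Function.Injective ρ) :
    ∃ π : preimage ρ →* H, Function.Surjective π ∧
      ∀ g, ρ (π g) = Matrix.ProjGenLinGroup.mk g.1 := by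
  refine ⟨(MonoidHom.ofInjective hρ).symm.toMonoidHom.comp
    (Matrix.ProjGenLinGroup.mk.subgroupComap ρ.range),
    (MonoidHom.ofInjective hρ).symm.surjective.comp
      (MonoidHom.subgroupComap_surjective_of_surjective _ _
        Matrix.ProjGenLinGroup.mk_surjective), fun g => ?_⟩
  exact congrArg Subtype.val ((MonoidHom.ofInjective hρ).apply_symm_apply
    (Matrix.ProjGenLinGroup.mk.subgroupComap ρ.range g))

/-- The scalar matrices, as a subgroup of the preimage of a projective representation. -/
noncomputable def scalarHom (ρ : H →* Matrix.ProjGenLinGroup (Fin m) k) : kˣ →* preimage ρ :=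
  (Matrix.GeneralLinearGroup.scalar (Fin m)).codRestrict (preimage ρ) fun c => by
    simp [preimage, one_mem]

theorem coe_scalarHom (ρ : H →* Matrix.ProjGenLinGroup (Fin m) k) (c : kˣ) :
    ((scalarHom ρ c).1 : Matrix (Fin m) (Fin m) k) = (c : k) • 1 := by
  change Matrix.scalar (Fin m) (c : k) = _
  rw [Matrix.scalar_apply, Matrix.smul_one_eq_diagonal]

theorem mul_scalarHom (ρ : H →* Matrix.ProjGenLinGroup (Fin m) k) (c : kˣ) (g : preimage ρ) :
    g * scalarHom ρ c = scalarHom ρ c * g := by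
  ext1
  ext1
  simp [coe_scalarHom]

theorem scalarHom_injective (hm : 0 < m) (ρ : H →* Matrix.ProjGenLinGroup (Fin m) k) :
    Function.Injective (scalarHom ρ) := by
  intro c d h
  have h1 := congrArg (fun g : preimage ρ => g.1.val ⟨0, hm⟩ ⟨0, hm⟩) h
  simp only [coe_scalarHom] at h1
  exact Units.ext (by simpa using h1)

theorem mk_eq_one_iff (ρ : H →* Matrix.ProjGenLinGroup (Fin m) k) (g : preimage ρ) :
    Matrix.ProjGenLinGroup.mk g.1 = 1 ↔ g ∈ (scalarHom ρ).range := by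
  rw [Matrix.ProjGenLinGroup.mk_eq_one, Matrix.GeneralLinearGroup.center_eq_range_scalar]
  exact ⟨fun ⟨c, hc⟩ => ⟨c, Subtype.ext hc⟩, fun ⟨c, hc⟩ => ⟨c, congrArg Subtype.val hc⟩⟩

/-- A normal subgroup whose lifts under a faithful primitive projective representation commute
is trivial. -/
theorem IsPrimitive.eq_bot_of_commute [IsAlgClosed k]
    {ρ : H →* Matrix.ProjGenLinGroup (Fin m) k} (hρ : IsPrimitive ρ)
    (hρi : Function.Injective ρ) {π : preimage ρ →* H} (hπ : Function.Surjective π)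
    (hρπ : ∀ g, ρ (π g) = Matrix.ProjGenLinGroup.mk g.1) (A : Subgroup H) [hAn : A.Normal]
    (hA : ∀ x y, π x ∈ A → π y ∈ A → x * y = y * x) : A = ⊥ := by
  rw [eq_bot_iff]
  intro a ha
  obtain ⟨x, rfl⟩ := hπ a
  have hcomm : ∀ x ∈ (A.comap π).map (preimage ρ).subtype,
      ∀ y ∈ (A.comap π).map (preimage ρ).subtype, x * y = y * x := by
    intro _ hx' _ hy'
    obtain ⟨x, hx, rfl⟩ := Subgroup.mem_map.1 hx'
    obtain ⟨y, hy, rfl⟩ := Subgroup.mem_map.1 hy'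
    exact congrArg Subtype.val (hA x y hx hy)
  have hconj : ∀ g ∈ preimage ρ, ∀ x ∈ (A.comap π).map (preimage ρ).subtype,
      g * x * g⁻¹ ∈ (A.comap π).map (preimage ρ).subtype := by
    intro g hg _ hx'
    obtain ⟨x, hx, rfl⟩ := Subgroup.mem_map.1 hx'
    exact Subgroup.mem_map_of_mem (preimage ρ).subtype
      (Subgroup.Normal.conj_mem inferInstance x hx ⟨g, hg⟩)
  obtain ⟨c, hc⟩ := hρ.scalar_of_commute _ hcomm hconj x.1
    (Subgroup.mem_map_of_mem (preimage ρ).subtype ha)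
  apply hρi
  rw [hρπ, map_one, Matrix.ProjGenLinGroup.mk_eq_one,
    Matrix.GeneralLinearGroup.mem_center_iff_val_mem_range_scalar]
  exact ⟨c, hc.symm⟩

end ProjRep

/-! ### The main argument -/

open ProjRep in
/-- A minimal extension of a simple group with a faithful primitive projective representation of
small degree is trivial. -/
theorem IsMinimalExtension.ker_eq_bot {G H k : Type*} [Group G] [IsSimpleGroup G]
    [Group H] [Finite H] {γ : H →* G} (hγ : IsMinimalExtension γ)
    [Field k] [IsAlgClosed k] {m : ℕ}
    {ρ : H →* Matrix.ProjGenLinGroup (Fin m) k} (hρi : Function.Injective ρ)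
    (hρ : ProjRep.IsPrimitive ρ)
    (hm : ringChar k ≠ 2 → (m : ℕ∞) < 2 ^ symplecticDegree G) : γ.ker = ⊥ := by
  by_contra hN
  obtain ⟨A, hAn, hAN, hAcent, hA0, hmin⟩ := hγ.exists_minimal_normal hN
  have hA : ∀ a ∈ A, ∀ b ∈ A, a * b = b * a := fun a ha b hb => hAcent b hb a (hAN ha)
  have hm0 : 0 < m := hρ.1.1
  obtain ⟨π, hπ, hρπ⟩ := exists_lift hρi
  have hi := scalarHom_injective hm0 ρ
  have hc := mul_scalarHom ρ
  have hker : π.ker = (scalarHom ρ).range := by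
    ext g
    rw [← mk_eq_one_iff, ← hρπ, MonoidHom.mem_ker]
    exact ⟨fun h => by rw [h, map_one], fun h => hρi (h.trans (map_one ρ).symm)⟩
  obtain ⟨ω, hω⟩ := exists_commutator_pairing (scalarHom ρ) π hi hπ hker hc A hA
  have hinv := pairing_conjNormal hi hπ hc hω
  have hself := pairing_self hi hπ hω
  -- The radical of ω is normal in `H`, so it is 1 or `A`; if it were `A`, the lifts of `A` would
  -- commute, against primitivity.
  have hinj : Function.Injective ω := by
    rw [← MonoidHom.ker_eq_bot_iff]
    have hn : (ω.ker.map A.subtype).Normal := by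
      refine ⟨?_⟩
      rintro _ ⟨a, ha, rfl⟩ h
      refine ⟨MulAut.conjNormal h a, ?_, by simp [MulAut.conjNormal_apply]⟩
      change ω (MulAut.conjNormal h a) = 1
      ext1 b
      obtain ⟨c, rfl⟩ := (MulAut.conjNormal h : MulAut A).surjective b
      rw [hinv, show ω a = 1 from ha]
      rfl
    rcases hmin _ hn (by rintro _ ⟨a, -, rfl⟩; exact a.2) with h | h
    · exact (Subgroup.map_eq_bot_iff_of_injective _ A.subtype_injective).1 h
    · exfalso
      have h1 : ∀ a, ω a = 1 := by
        intro a
        obtain ⟨b, hb, hba⟩ := h.ge a.2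
        rwa [show b = a from Subtype.ext hba] at hb
      apply hA0
      refine hρ.eq_bot_of_commute hρi hπ hρπ A fun x y hx hy => ?_
      have := hω ⟨π x, hx⟩ ⟨π y, hy⟩ x y rfl rfl
      rwa [h1, MonoidHom.one_apply, map_one, one_mul] at this
  obtain ⟨p, hp, hexp⟩ := exists_prime_exponent A hA hA0 hmin
  obtain ⟨a₀, ha₀⟩ : ∃ a : A, a ≠ 1 := by
    have := (Subgroup.nontrivial_iff_ne_bot A).2 hA0
    exact exists_ne 1
  rcases hp.eq_two_or_odd' with rfl | hodd
  -- The values of ω square to 1, and in characteristic 2 this makes ω trivial.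
  · have hchar : ringChar k ≠ 2 := by
      intro h2
      have : CharP k 2 := h2 ▸ ringChar.charP k
      apply ha₀
      apply hinj
      rw [map_one]
      ext1 b
      have h3 : ω a₀ b ^ 2 = 1 := by
        rw [← MonoidHom.pow_apply, ← map_pow,
          show a₀ ^ 2 = 1 from Subtype.ext (hexp _ a₀.2), map_one, MonoidHom.one_apply]
      have h4 := congrArg Units.val h3
      rw [Units.val_pow_eq_pow_val, Units.val_one, sq_eq_one_iff, CharTwo.neg_eq, or_self] at h4
      exact Units.ext h4
    have hconj : (MulAut.conjNormal : H →* MulAut A).ker = γ.ker := by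
      have hmem : ∀ h, h ∈ (MulAut.conjNormal : H →* MulAut A).ker ↔ ∀ a ∈ A, h * a = a * h := by
        intro h
        rw [MonoidHom.mem_ker]
        constructor
        · intro h1 a ha
          have := congrArg Subtype.val (DFunLike.congr_fun h1 (⟨a, ha⟩ : A))
          rw [MulAut.conjNormal_apply] at this
          exact mul_inv_eq_iff_eq_mul.1 this
        · intro h1
          ext a
          rw [MulAut.conjNormal_apply, h1 a a.2]
          simp
      refine le_antisymm ((hγ.le_ker_or_eq_top _).resolve_right fun htop => ?_) fun n hn => ?_
      -- If `A` were central in `H`, minimality would make it cyclic, and an alternating pairing on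
      -- a cyclic group is trivial.
      · have hcentral : ∀ h, ∀ a ∈ A, h * a = a * h := fun h => (hmem h).1 (htop.ge (Subgroup.mem_top h))
        have hz : (Subgroup.zpowers (a₀ : H)).Normal := by
          refine ⟨fun b hb h => ?_⟩
          rwa [hcentral h b (Subgroup.zpowers_le.2 a₀.2 hb), mul_inv_cancel_right]
        have hzA : Subgroup.zpowers (a₀ : H) = A :=
          (hmin _ hz (Subgroup.zpowers_le.2 a₀.2)).resolve_left fun h =>
            ha₀ (Subtype.ext (Subgroup.zpowers_eq_bot.1 h))
        apply ha₀
        apply hinj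
        rw [map_one]
        ext1 b
        obtain ⟨n, hn⟩ := Subgroup.mem_zpowers_iff.1 (hzA.ge b.2)
        rw [← show a₀ ^ n = b from Subtype.ext hn, map_zpow, hself, one_zpow]
        rfl
      · exact (hmem n).2 fun a ha => hAcent a ha n hn
    obtain ⟨n, hcard, hemb⟩ := exists_embedsIrreduciblyInSp_of_pairing hγ.1 A hA hA0 hmin hconj
      hexp ω hinj hself hinv
    choose L hL using fun a : A => hπ a
    have hle := card_le_sq_of_pairing hm0 ω hinj (fun a => (L a).1) (fun a b => by
      have := congrArg (fun g : preimage ρ => g.1.val) (hω a b (L a) (L b) (hL a) (hL b))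
      simpa [coe_scalarHom] using this)
    rw [hcard, mul_comm, pow_mul] at hle
    have hle' : 2 ^ n ≤ m := (Nat.pow_le_pow_iff_left two_ne_zero).1 hle
    refine (hm hchar).not_ge ?_
    calc (2 : ℕ∞) ^ symplecticDegree G ≤ 2 ^ (n : ℕ∞) :=
          ENat.epow_right_mono two_ne_zero (sInf_le ⟨n, rfl, hemb⟩)
      _ = ((2 ^ n : ℕ) : ℕ∞) := by rw [ENat.epow_natCast]; push_cast; rfl
      _ ≤ m := by exact_mod_cast hle'
  · let _ := unitsDivisibleBy k
    obtain ⟨M, hM, hMA⟩ := exists_complement_of_odd (scalarHom ρ) π hi hπ hker hc A ω hω hinj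
      (pairing_surjective ω hinj) p hodd hexp
    -- A complement of `A` supplements `γ.ker`, so it is all of `H` and `A` is trivial.
    have hMtop := hγ.eq_top_of_sup_ker (top_le_iff.1 (hM.symm.le.trans (sup_le_sup_left hAN M)))
    rw [hMtop, top_inf_eq] at hMA
    exact hA0 hMA

theorem theorem1 {G H k : Type*} [Group G] [Finite G] [IsSimpleGroup G]
    (hG : ¬ ∀ a b : G, a * b = b * a)
    [Group H] [Finite H] (γ : H →* G) (hγ : IsMinimalExtension γ)
    [Field k] [IsAlgClosed k] (m : ℕ)
    (ρ : H →* Matrix.ProjGenLinGroup (Fin m) k) (hρ : ProjRep.IsPrimitive ρ)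
    (hm : ringChar k ≠ 2 → (m : ℕ∞) < 2 ^ symplecticDegree G) :
    γ.ker ≤ ρ.ker := by
  rcases hγ.le_ker_or_eq_top ρ.ker with hle | htop
  · let γ' : H ⧸ ρ.ker →* G := QuotientGroup.lift ρ.ker γ hle
    let ρ' : H ⧸ ρ.ker →* Matrix.ProjGenLinGroup (Fin m) k := QuotientGroup.kerLift ρ
    have hγ' : IsMinimalExtension γ' := by
      refine ⟨fun g => ?_, fun K hK => ?_⟩
      · obtain ⟨h, rfl⟩ := hγ.1 g
        exact ⟨h, rfl⟩
      · have hsurj := QuotientGroup.mk'_surjective ρ.ker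
        have h1 : K.comap (QuotientGroup.mk' ρ.ker) < ⊤ := by
          rw [← Subgroup.comap_top (QuotientGroup.mk' ρ.ker)]
          exact (Subgroup.comap_lt_comap_of_surjective hsurj).2 hK
        have h2 := hγ.2 _ h1
        rwa [show γ = γ'.comp (QuotientGroup.mk' ρ.ker) from rfl, ← Subgroup.map_map,
          Subgroup.map_comap_eq_self_of_surjective hsurj] at h2
    -- Primitivity depends only on the image, which is unchanged by passing to the quotient.
    have hpre : ProjRep.preimage ρ' = ProjRep.preimage ρ := by
      have : ρ'.range = ρ.range := by
        ext x
        refine ⟨?_, ?_⟩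
        · rintro ⟨q, rfl⟩
          obtain ⟨h, rfl⟩ := QuotientGroup.mk'_surjective ρ.ker q
          exact ⟨h, rfl⟩
        · rintro ⟨h, rfl⟩
          exact ⟨h, rfl⟩
      rw [ProjRep.preimage, ProjRep.preimage, this]
    have hρ' : ProjRep.IsPrimitive ρ' := by
      unfold ProjRep.IsPrimitive ProjRep.IsIrreducible ProjRep.IsImprimitive at hρ ⊢
      rwa [hpre]
    have hbot := hγ'.ker_eq_bot (QuotientGroup.kerLift_injective ρ) hρ' hm
    intro h hh
    have h1 : (h : H ⧸ ρ.ker) ∈ γ'.ker := hh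
    rw [hbot, Subgroup.mem_bot] at h1
    exact (QuotientGroup.eq_one_iff h).1 h1
  · rw [htop]
    exact le_top
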